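/- All linear spaces are over $\mathbb{C}$ and $C(K)$ denotes the algebra of complex-valued continuous functions on $K$ with the sup-norm. Let $K_X, K_Y$ be compact Hausdorff spaces and let $X$ be a Banach $C(K_X)$-module and $Y$ a Banach $C(K_Y)$-module; that is, $X$ and $Y$ are complex Banach spaces with isometric unital algebra homomorphisms $C(K_X)\to L(X)$ and $C(K_Y)\to L(Y)$, through which functions act on vectors, $(f,x)\mapsto fx$. For $x\in X$ put $$\Delta(x)=\mathrm{cl}\{fx: f\in C(K_X),\ \|f\|\le 1\},\quad X(x)=\mathrm{cl}\{fx: f\in C(K_X)\},\quad X_+(x)=\mathrm{cl}\{fx: f\in C(K_X),\ f\ge 0\}$$ (norm closures in $X$). Write $x\,d\,y$ if $\Delta(x+y)=\Delta(x)+\Delta(y)$ and $\Delta(x)\cap\Delta(y)=\{0\}$. The cyclic subspace $X(x)$ is a complex Banach lattice whose real part $X(x)_r=X_+(x)-X_+(x)$ is ordered by the cone $X_+(x)$ and whose modulus is $|u+iv|=\sup_{\theta}\,(u\cos\theta+v\sin\theta)$ for $u,v\in X(x)_r$; elements $y,z\in X(x)$ are disjoint in $X(x)$, $y\perp z$, if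 $|y|\wedge|z|=0$. The same notation is used in $Y$. Theorem. Let $T:X\to Y$ be a bounded linear operator. The following are equivalent. 1. For all $x,y\in X$, $x\,d\,y$ in $X$ implies $Tx\,d\,Ty$ in $Y$. 2. For each $x\in X$, $T(X(x))\subseteq Y(Tx)$, and the restriction $T|_{X(x)}:X(x)\to Y(Tx)$ is disjointness preserving: for all $y,z\in X(x)$, $y\perp z$ in the Banach lattice $X(x)$ implies $Ty\perp Tz$ in the Banach lattice $Y(Tx)$. -/

import Mathlib

open scoped Pointwise ComplexOrder

/-- An (exact, isometric) Banach `C(K)`-module: a unital algebra homomorphism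
`m : C(K) → L(X)` that is an isometry (in particular bounded and injective). It is meant for a
compact Hausdorff space `K` and a complex Banach space `X`. -/
structure BanachCKModule (K X : Type*) [TopologicalSpace K] [CompactSpace K]
    [NormedAddCommGroup X] [NormedSpace ℂ X] where
  /-- the action of `C(K)` on `X` -/
  m : C(K, ℂ) →ₐ[ℂ] (X →L[ℂ] X)
  isometry_m : Isometry m

namespace BanachCKModule

variable {K X : Type*} [TopologicalSpace K] [CompactSpace K]
  [NormedAddCommGroup X] [NormedSpace ℂ X]

/-- The set `Δ(x) = cl {f x : f ∈ C(K), ‖f‖ ≤ 1}`. -/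
def Delta (M : BanachCKModule K X) (x : X) : Set X :=
  closure {z | ∃ f : C(K, ℂ), ‖f‖ ≤ 1 ∧ M.m f x = z}

/-- The disjointness relation `x d y` of elements of a Banach `C(K)`-module:
`Δ(x + y) = Δ(x) + Δ(y)` and `Δ(x) ∩ Δ(y) = {0}`. -/
def DDisjoint (M : BanachCKModule K X) (x y : X) : Prop :=
  M.Delta (x + y) = M.Delta x + M.Delta y ∧ M.Delta x ∩ M.Delta y = {0}

/-- The cyclic subspace `X(x) = cl {f x : f ∈ C(K)}`. -/
noncomputable def cyclicSubspace (M : BanachCKModule K X) (x : X) : Submodule ℂ X :=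
  (LinearMap.range
    ((ContinuousLinearMap.apply ℂ X x).toLinearMap ∘ₗ M.m.toLinearMap)).topologicalClosure

/-- The cone `X₊(x) = cl {f x : f ∈ C(K), f ≥ 0}` of the cyclic subspace `X(x)`. -/
def cyclicCone (M : BanachCKModule K X) (x : X) : Set X :=
  closure {z | ∃ f : C(K, ℂ), 0 ≤ f ∧ M.m f x = z}

theorem mem_cyclicSubspace_iff (M : BanachCKModule K X) (x z : X) :
    z ∈ M.cyclicSubspace x ↔ z ∈ closure {z | ∃ f : C(K, ℂ), M.m f x = z} := by
  rfl

theorem zero_mem_cyclicCone (M : BanachCKModule K X) (x : X) : (0 : X) ∈ M.cyclicCone x :=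
  subset_closure ⟨0, le_rfl, by simp⟩

theorem add_mem_cyclicCone (M : BanachCKModule K X) (x : X) {a b : X}
    (ha : a ∈ M.cyclicCone x) (hb : b ∈ M.cyclicCone x) : a + b ∈ M.cyclicCone x := by
  refine map_mem_closure₂ continuous_add ha hb ?_
  rintro _ ⟨f, hf, rfl⟩ _ ⟨g, hg, rfl⟩
  exact ⟨f + g, add_nonneg hf hg, by simp⟩

theorem smul_mem_cyclicCone (M : BanachCKModule K X) (x : X) {r : ℝ} (hr : 0 ≤ r) {a : X}
    (ha : a ∈ M.cyclicCone x) : r • a ∈ M.cyclicCone x := by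
  refine map_mem_closure (continuous_const_smul r) ha ?_
  rintro _ ⟨f, hf, rfl⟩
  refine ⟨(r : ℂ) • f, fun k => ?_, ?_⟩
  · exact mul_nonneg (Complex.zero_le_real.2 hr) (hf k)
  · rw [map_smul, smul_apply, Complex.coe_smul]

/-- The cone `X₊(x)` is proper. -/
theorem eq_zero_of_mem_cyclicCone (M : BanachCKModule K X) (x : X) {z : X}
    (hz : z ∈ M.cyclicCone x) (hz' : -z ∈ M.cyclicCone x) : z = 0 := by
  have norm_le : ∀ (h : C(K, ℂ)) (y : X), ‖h‖ ≤ 1 → ‖M.m h y‖ ≤ ‖y‖ := by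
    intro h y hh
    have h1 : ‖M.m h‖ = ‖h‖ :=
      M.isometry_m.norm_map_of_map_zero (map_zero _) h
    calc ‖M.m h y‖ ≤ ‖M.m h‖ * ‖y‖ := (M.m h).le_opNorm y
      _ ≤ 1 * ‖y‖ := by rw [h1]; gcongr
      _ = ‖y‖ := one_mul _
  have key : ∀ f g : C(K, ℂ), 0 ≤ f → 0 ≤ g → ∀ δ : ℝ, 0 < δ →
      ‖M.m f x‖ ≤ ‖M.m (f + g) x‖ + δ * ‖x‖ := by
    intro f g hf hg δ hδ
    have hpos : ∀ k, 0 < f k + g k + (δ : ℂ) := fun k =>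
      add_pos_of_nonneg_of_pos (add_nonneg (hf k) (hg k)) (by exact_mod_cast hδ)
    let h : C(K, ℂ) := ⟨fun k => f k / (f k + g k + (δ : ℂ)),
      Continuous.div (by fun_prop) (by fun_prop) (fun k => (hpos k).ne')⟩
    have hh : ‖h‖ ≤ 1 := by
      refine (ContinuousMap.norm_le _ zero_le_one).2 fun k => ?_
      change ‖f k / (f k + g k + (δ : ℂ))‖ ≤ 1
      rw [norm_div]
      refine div_le_one_of_le₀ ?_ (norm_nonneg _)
      have h1 : (f k) ≤ f k + g k + (δ : ℂ) := by
        rw [add_assoc]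
        exact le_add_of_nonneg_right (add_nonneg (hg k) (by exact_mod_cast hδ.le))
      have h2 := Complex.le_def.1 h1
      have h3 := Complex.norm_of_nonneg' (x := f k) (hf k)
      have h4 := Complex.norm_of_nonneg' (hpos k).le
      have h5 := congrArg Complex.re h3
      have h6 := congrArg Complex.re h4
      simp only [Complex.ofReal_re] at h5 h6
      rw [h5, h6]
      exact h2.1
    have hfeq : f = h * (f + g) + (δ : ℂ) • h := by
      ext k
      change f k = f k / (f k + g k + (δ : ℂ)) * (f k + g k)
        + (δ : ℂ) * (f k / (f k + g k + (δ : ℂ)))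
      have := (hpos k).ne'
      field_simp
    calc ‖M.m f x‖ = ‖M.m h (M.m (f + g) x) + (δ : ℂ) • M.m h x‖ := by
          conv_lhs => rw [hfeq]
          rw [map_add, map_mul, map_smul]
          rfl
      _ ≤ ‖M.m h (M.m (f + g) x)‖ + ‖(δ : ℂ) • M.m h x‖ := norm_add_le _ _
      _ ≤ ‖M.m (f + g) x‖ + δ * ‖x‖ := by
          rw [norm_smul, Complex.norm_real, Real.norm_of_nonneg hδ.le]
          gcongr
          · exact norm_le _ _ hh
          · exact norm_le _ _ hh
  rw [← norm_le_zero_iff]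
  refine le_of_forall_pos_le_add fun ε hε => ?_
  obtain ⟨_, ⟨f, hf, rfl⟩, hfz⟩ := Metric.mem_closure_iff.1 hz (ε / 4) (by positivity)
  obtain ⟨_, ⟨g, hg, rfl⟩, hgz⟩ := Metric.mem_closure_iff.1 hz' (ε / 4) (by positivity)
  have hk := key f g hf hg (ε / (4 * (‖x‖ + 1))) (by positivity)
  have hδ : ε / (4 * (‖x‖ + 1)) * ‖x‖ ≤ ε / 4 := by
    rw [div_mul_eq_mul_div, div_le_div_iff₀ (by positivity) (by norm_num)]
    nlinarith [norm_nonneg x]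
  rw [dist_eq_norm] at hfz hgz
  have e1 : ‖M.m (f + g) x‖ ≤ ‖z - M.m f x‖ + ‖-z - M.m g x‖ := by
    have : M.m (f + g) x = -((z - M.m f x) + (-z - M.m g x)) := by
      rw [map_add, add_apply]; abel
    rw [this, norm_neg]
    exact norm_add_le _ _
  have e2 : ‖z‖ ≤ ‖z - M.m f x‖ + ‖M.m f x‖ := by
    simpa using norm_add_le (z - M.m f x) (M.m f x)
  linarith

/-- The real part `X(x)_r = X₊(x) - X₊(x)` of the cyclic subspace `X(x)`. -/
noncomputable def cyclicReal (M : BanachCKModule K X) (x : X) : Submodule ℝ X where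
  carrier := {z | ∃ a ∈ M.cyclicCone x, ∃ b ∈ M.cyclicCone x, z = a - b}
  zero_mem' := ⟨0, M.zero_mem_cyclicCone x, 0, M.zero_mem_cyclicCone x, by simp⟩
  add_mem' := by
    rintro _ _ ⟨a, ha, b, hb, rfl⟩ ⟨c, hc, d, hd, rfl⟩
    exact ⟨a + c, M.add_mem_cyclicCone x ha hc, b + d, M.add_mem_cyclicCone x hb hd, by abel⟩
  smul_mem' := by
    rintro r _ ⟨a, ha, b, hb, rfl⟩
    rcases le_total 0 r with hr | hr
    · exact ⟨r • a, M.smul_mem_cyclicCone x hr ha, r • b, M.smul_mem_cyclicCone x hr hb,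
        smul_sub r a b⟩
    · have hr' : 0 ≤ -r := neg_nonneg.2 hr
      exact ⟨(-r) • b, M.smul_mem_cyclicCone x hr' hb, (-r) • a, M.smul_mem_cyclicCone x hr' ha,
        by rw [smul_sub, neg_smul, neg_smul]; abel⟩

/-- The type of elements of the real part `X(x)_r`, which carries the order defined by the cone
`X₊(x)`. -/
def CyclicReal (M : BanachCKModule K X) (x : X) : Type _ := M.cyclicReal x

noncomputable instance (M : BanachCKModule K X) (x : X) : AddCommGroup (M.CyclicReal x) :=
  inferInstanceAs (AddCommGroup (M.cyclicReal x))

noncomputable instance (M : BanachCKModule K X) (x : X) : Module ℝ (M.CyclicReal x) :=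
  inferInstanceAs (Module ℝ (M.cyclicReal x))

/-- The inclusion of `X(x)_r` into `X`. -/
noncomputable def CyclicReal.incl {M : BanachCKModule K X} {x : X} : M.CyclicReal x →ₗ[ℝ] X :=
  (M.cyclicReal x).subtype

/-- The order of `X(x)_r`: `a ≤ b` if and only if `b - a ∈ X₊(x)`. -/
instance (M : BanachCKModule K X) (x : X) : PartialOrder (M.CyclicReal x) where
  le a b := CyclicReal.incl b - CyclicReal.incl a ∈ M.cyclicCone x
  le_refl a := by simpa using M.zero_mem_cyclicCone x
  le_trans a b c hab hbc := by
    have h := M.add_mem_cyclicCone x hab hbc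
    rwa [show CyclicReal.incl b - CyclicReal.incl a + (CyclicReal.incl c - CyclicReal.incl b)
      = CyclicReal.incl c - CyclicReal.incl a by abel] at h
  le_antisymm a b hab hba := by
    have h := M.eq_zero_of_mem_cyclicCone x hab (by rwa [neg_sub])
    exact Subtype.ext (sub_eq_zero.1 h).symm

/-- `a` is the modulus of `z` in the complex lattice `X(x)`: writing `z = u + i v` with
`u, v ∈ X(x)_r`, one has `a = sup {(cos θ) u + (sin θ) v : θ ∈ ℝ}` in `X(x)_r`. -/
def IsModulus (M : BanachCKModule K X) (x z : X) (a : M.CyclicReal x) : Prop :=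
  ∃ u v : M.CyclicReal x, z = CyclicReal.incl u + Complex.I • CyclicReal.incl v ∧
    IsLUB (Set.range fun θ : ℝ => Real.cos θ • u + Real.sin θ • v) a

/-- `y ⊥ z` in the complex lattice `X(x)`, that is `|y| ∧ |z| = 0`. -/
def CyclicDisjoint (M : BanachCKModule K X) (x y z : X) : Prop :=
  ∃ a b : M.CyclicReal x, M.IsModulus x y a ∧ M.IsModulus x z b ∧ IsGLB {a, b} 0

end BanachCKModule

/-! Both notions of disjointness reduce to `Separated`: for every `ε` some `a` in `C(K, ℝ)` with `0
≤ a ≤ 1` makes `(1 - a) y` and `a z` smaller than `ε`. This condition mentions no cyclic subspace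
and no order. It is equivalent to `DDisjoint` (`dDisjoint_iff_separated`), it follows from
disjointness in any `X(x)` (`CyclicDisjoint.separated`), and it implies disjointness in every `X(x)`
containing both vectors (`Separated.cyclicDisjoint`). The tool throughout is that `‖f x‖` is
monotone in `|f|` (`norm_apply_mono`), so pointwise inequalities between functions become norm
estimates on orbits.

Given 2, separated `x` and `y` both lie in `X(x + y)`, are disjoint there, and so have separated
images. Given 1, the only remaining difficulty is `T(X(x)) ⊆ Y(Tx)`. Let `S r = T(r x)` and `0 ≤ f ≤
1`. Cut `2n f` into layers `r_j`, the truncations of `2n f - j` to `[0, 1]`. Since `r_{j+1}` and `1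
- r_j` are disjoint, some `b_j` almost separates their images, and `S r_j - b_j S 1` is, up to a
small error, `(1 - b_j) S(r_j - r_{j+1})`. Differences with indices of equal parity are disjoint, so
these terms add up to a vector bounded independently of `n`. Division by `2n` shows that `S f` is
close to `(2n)⁻¹ (∑ b_j) S 1`. -/

namespace BanachCKModule

open Filter Topology

/-! ### Real and complex continuous functions. -/

section Functions

variable {K : Type*} [TopologicalSpace K]

/-- The complex-valued function underlying a real-valued one. -/
def ofReal (r : C(K, ℝ)) : C(K, ℂ) := ⟨fun k => (r k : ℂ), by fun_prop⟩

@[simp] theorem ofReal_apply (r : C(K, ℝ)) (k : K) : ofReal r k = (r k : ℂ) := rfl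

/-- The modulus of a complex-valued continuous function. -/
noncomputable def modulus (f : C(K, ℂ)) : C(K, ℝ) := ⟨fun k => ‖f k‖, by fun_prop⟩

@[simp] theorem modulus_apply (f : C(K, ℂ)) (k : K) : modulus f k = ‖f k‖ := rfl

end Functions

/-! ### Monotonicity of the orbit norm. -/

section Norm

variable {K X : Type*} [TopologicalSpace K] [CompactSpace K]
  [NormedAddCommGroup X] [NormedSpace ℂ X] (M : BanachCKModule K X)

theorem norm_apply_le (f : C(K, ℂ)) (y : X) : ‖M.m f y‖ ≤ ‖f‖ * ‖y‖ := by
  have h1 : ‖M.m f‖ = ‖f‖ := M.isometry_m.norm_map_of_map_zero (map_zero _) f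
  exact h1 ▸ (M.m f).le_opNorm y

theorem norm_apply_le_of_norm_le_one {f : C(K, ℂ)} (hf : ‖f‖ ≤ 1) (y : X) :
    ‖M.m f y‖ ≤ ‖y‖ :=
  (M.norm_apply_le f y).trans (mul_le_of_le_one_left (norm_nonneg _) hf)

theorem apply_mul (f g : C(K, ℂ)) (y : X) : M.m (f * g) y = M.m f (M.m g y) := by
  rw [map_mul]; rfl

/-- The norm of `f x` is a monotone function of the modulus of `f`. -/
theorem norm_apply_mono {f g : C(K, ℂ)} (h : ∀ k, ‖f k‖ ≤ ‖g k‖) (x : X) :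
    ‖M.m f x‖ ≤ ‖M.m g x‖ := by
  have key : ∀ δ : ℝ, 0 < δ → ‖M.m f x‖ ≤ ‖M.m g x‖ + δ * ‖x‖ := by
    intro δ hδ
    have hden : ∀ k, 0 < ‖g k‖ ^ 2 + δ ^ 2 := fun k => by positivity
    have hne : ∀ k, (((‖g k‖ ^ 2 + δ ^ 2 : ℝ)) : ℂ) ≠ 0 := fun k => by
      exact_mod_cast (hden k).ne'
    -- A regularised quotient `f / g`: `f = q g + r` with `|q| ≤ 1`, while `δ |g| ≤ |g|² + δ²` gives
    -- `|r| ≤ δ`.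
    let q : C(K, ℂ) := ⟨fun k => f k * star (g k) / ((‖g k‖ ^ 2 + δ ^ 2 : ℝ) : ℂ),
      Continuous.div (by fun_prop) (by fun_prop) hne⟩
    let r : C(K, ℂ) := ⟨fun k => f k * ((δ ^ 2 : ℝ) : ℂ) / ((‖g k‖ ^ 2 + δ ^ 2 : ℝ) : ℂ),
      Continuous.div (by fun_prop) (by fun_prop) hne⟩
    have hq : ‖q‖ ≤ 1 := by
      refine (ContinuousMap.norm_le _ zero_le_one).2 fun k => ?_
      change ‖f k * star (g k) / ((‖g k‖ ^ 2 + δ ^ 2 : ℝ) : ℂ)‖ ≤ 1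
      rw [norm_div, norm_mul, norm_star, Complex.norm_real, Real.norm_of_nonneg (hden k).le,
        div_le_one (hden k)]
      nlinarith [h k, norm_nonneg (g k), mul_le_mul_of_nonneg_right (h k) (norm_nonneg (g k))]
    have hr : ‖r‖ ≤ δ := by
      refine (ContinuousMap.norm_le _ hδ.le).2 fun k => ?_
      change ‖f k * ((δ ^ 2 : ℝ) : ℂ) / ((‖g k‖ ^ 2 + δ ^ 2 : ℝ) : ℂ)‖ ≤ δ
      rw [norm_div, norm_mul, Complex.norm_real, Complex.norm_real,
        Real.norm_of_nonneg (hden k).le, Real.norm_of_nonneg (sq_nonneg δ), div_le_iff₀ (hden k)]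
      have h1 : ‖f k‖ * δ ≤ ‖g k‖ * δ := mul_le_mul_of_nonneg_right (h k) hδ.le
      have h2 : ‖f k‖ * δ ≤ ‖g k‖ ^ 2 + δ ^ 2 := by nlinarith [sq_nonneg (‖g k‖ - δ)]
      nlinarith
    have hfeq : f = q * g + r := by
      ext k
      change f k = f k * star (g k) / ((‖g k‖ ^ 2 + δ ^ 2 : ℝ) : ℂ) * g k
        + f k * ((δ ^ 2 : ℝ) : ℂ) / ((‖g k‖ ^ 2 + δ ^ 2 : ℝ) : ℂ)
      have h0 := hne k
      have h1 : star (g k) * g k = ((‖g k‖ ^ 2 : ℝ) : ℂ) := by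
        rw [Complex.ofReal_pow]; exact Complex.conj_mul' (g k)
      rw [div_mul_eq_mul_div, mul_assoc, h1, ← add_div, ← mul_add, ← Complex.ofReal_add,
        mul_div_cancel_right₀ _ h0]
    calc ‖M.m f x‖ = ‖M.m q (M.m g x) + M.m r x‖ := by
          conv_lhs => rw [hfeq, map_add, add_apply, apply_mul]
      _ ≤ ‖M.m q (M.m g x)‖ + ‖M.m r x‖ := norm_add_le _ _
      _ ≤ ‖M.m g x‖ + δ * ‖x‖ := by
          gcongr
          · exact M.norm_apply_le_of_norm_le_one hq _
          · exact (M.norm_apply_le r x).trans (by gcongr)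
  refine le_of_forall_pos_le_add fun ε hε => ?_
  refine (key (ε / (‖x‖ + 1)) (by positivity)).trans ?_
  gcongr
  rw [div_mul_eq_mul_div, div_le_iff₀ (by positivity)]
  nlinarith [norm_nonneg x]

/-- The orbit map `r ↦ r x` on real-valued functions. -/
noncomputable def realOrbit (x : X) : C(K, ℝ) →ₗ[ℝ] X where
  toFun r := M.m (ofReal r) x
  map_add' r s := by
    rw [← add_apply, ← map_add]; congr 2; ext k; simp
  map_smul' c r := by
    have : ofReal (c • r) = (c : ℂ) • ofReal r := by ext k; simp
    rw [this, map_smul, smul_apply, Complex.coe_smul, RingHom.id_apply]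

theorem realOrbit_apply (x : X) (r : C(K, ℝ)) : M.realOrbit x r = M.m (ofReal r) x := rfl

theorem realOrbit_one (x : X) : M.realOrbit x 1 = x := by
  have : ofReal (1 : C(K, ℝ)) = 1 := by ext k; simp
  rw [realOrbit_apply, this, map_one]; rfl

theorem realOrbit_one_sub (x : X) (a : C(K, ℝ)) :
    M.realOrbit x (1 - a) = x - M.realOrbit x a := by
  rw [map_sub, realOrbit_one]

theorem norm_apply_eq_of_norm_eq {f g : C(K, ℂ)} (h : ∀ k, ‖f k‖ = ‖g k‖) (x : X) :
    ‖M.m f x‖ = ‖M.m g x‖ :=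
  le_antisymm (M.norm_apply_mono (fun k => (h k).le) x) (M.norm_apply_mono (fun k => (h k).ge) x)

theorem norm_apply_le_add {f g h : C(K, ℂ)} (hf : ∀ k, ‖f k‖ ≤ ‖g k‖ + ‖h k‖) (x : X) :
    ‖M.m f x‖ ≤ ‖M.m g x‖ + ‖M.m h x‖ := by
  calc ‖M.m f x‖ ≤ ‖M.m (ofReal (modulus g + modulus h)) x‖ := by
        refine M.norm_apply_mono (fun k => ?_) x
        rw [ofReal_apply, Complex.norm_real]
        exact (hf k).trans (le_abs_self _)
    _ = ‖M.realOrbit x (modulus g) + M.realOrbit x (modulus h)‖ := by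
        rw [← map_add, realOrbit_apply]
    _ ≤ ‖M.realOrbit x (modulus g)‖ + ‖M.realOrbit x (modulus h)‖ := norm_add_le _ _
    _ = ‖M.m g x‖ + ‖M.m h x‖ := by
        rw [realOrbit_apply, realOrbit_apply]
        congr 1 <;> exact M.norm_apply_eq_of_norm_eq (fun k => by simp) x

theorem norm_realOrbit_mono {r s : C(K, ℝ)} (h : ∀ k, |r k| ≤ |s k|) (x : X) :
    ‖M.realOrbit x r‖ ≤ ‖M.realOrbit x s‖ :=
  M.norm_apply_mono (fun k => by simpa using h k) x

theorem norm_ofReal_le_one {r : C(K, ℝ)} (h : ∀ k, |r k| ≤ 1) : ‖ofReal r‖ ≤ 1 :=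
  (ContinuousMap.norm_le _ zero_le_one).2 fun k => by simpa using h k

theorem norm_realOrbit_le {r : C(K, ℝ)} (h : ∀ k, |r k| ≤ 1) (x : X) : ‖M.realOrbit x r‖ ≤ ‖x‖ :=
  M.norm_apply_le_of_norm_le_one (norm_ofReal_le_one h) x

/-- Convergence of orbits passes to sequences of functions with smaller increments. -/
theorem exists_tendsto_apply [CompleteSpace X] {f g : ℕ → C(K, ℂ)} {x y : X} (c : ℝ)
    (h : ∀ n m k, ‖g n k - g m k‖ ≤ c * ‖f n k - f m k‖)
    (hf : Tendsto (fun n => M.m (f n) x) atTop (𝓝 y)) :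
    ∃ z, Tendsto (fun n => M.m (g n) x) atTop (𝓝 z) := by
  refine cauchySeq_tendsto_of_complete ?_
  have hc := hf.cauchySeq
  rw [Metric.cauchySeq_iff] at hc ⊢
  intro ε hε
  obtain ⟨n₀, hn₀⟩ := hc (ε / (|c| + 1)) (by positivity)
  refine ⟨n₀, fun m hm n hn => ?_⟩
  have h1 := hn₀ m hm n hn
  rw [dist_eq_norm, ← sub_apply, ← map_sub] at h1 ⊢
  rw [lt_div_iff₀ (by positivity)] at h1
  calc ‖M.m (g m - g n) x‖ ≤ ‖M.m ((c : ℂ) • (f m - f n)) x‖ := by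
        refine M.norm_apply_mono (fun k => ?_) x
        refine (h m n k).trans ?_
        simp only [ContinuousMap.smul_apply, ContinuousMap.sub_apply, norm_smul, Complex.norm_real,
          Real.norm_eq_abs]
        gcongr
        exact le_abs_self c
    _ = |c| * ‖M.m (f m - f n) x‖ := by
        rw [map_smul, smul_apply, norm_smul, Complex.norm_real, Real.norm_eq_abs]
    _ < ε := by nlinarith [norm_nonneg (M.m (f m - f n) x)]

end Norm

/-! ### Equivalence of `DDisjoint` and `Separated`. -/

section Separated

variable {K X : Type*} [TopologicalSpace K] [CompactSpace K]
  [NormedAddCommGroup X] [NormedSpace ℂ X] (M : BanachCKModule K X)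

/-- `y` and `z` can be approximately separated by functions with values in `[0, 1]`. -/
def Separated (y z : X) : Prop :=
  ∀ ε : ℝ, 0 < ε → ∃ a : C(K, ℝ), (∀ k, 0 ≤ a k) ∧ (∀ k, a k ≤ 1) ∧
    ‖M.realOrbit y (1 - a)‖ < ε ∧ ‖M.realOrbit z a‖ < ε

theorem apply_mem_Delta {f : C(K, ℂ)} (hf : ‖f‖ ≤ 1) (x : X) : M.m f x ∈ M.Delta x :=
  subset_closure ⟨f, hf, rfl⟩

theorem mem_Delta_iff {x z : X} : z ∈ M.Delta x ↔
    ∃ f : ℕ → C(K, ℂ), (∀ n, ‖f n‖ ≤ 1) ∧ Tendsto (fun n => M.m (f n) x) atTop (𝓝 z) := by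
  constructor
  · intro hz
    obtain ⟨w, hw, hlim⟩ := mem_closure_iff_seq_limit.1 hz
    choose f hf hfw using hw
    exact ⟨f, hf, by simpa only [hfw] using hlim⟩
  · rintro ⟨f, hf, hlim⟩
    exact mem_closure_of_tendsto hlim (Eventually.of_forall fun n => ⟨f n, hf n, rfl⟩)

theorem zero_mem_Delta (x : X) : (0 : X) ∈ M.Delta x :=
  subset_closure ⟨0, by simp, by simp⟩

theorem self_mem_Delta (x : X) : x ∈ M.Delta x :=
  subset_closure ⟨1, (ContinuousMap.norm_le _ zero_le_one).2 fun k => by simp, by simp⟩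

theorem norm_le_of_mem_Delta {x z : X} (h : z ∈ M.Delta x) : ‖z‖ ≤ ‖x‖ := by
  obtain ⟨f, hf, hlim⟩ := M.mem_Delta_iff.1 h
  exact le_of_tendsto hlim.norm
    (Eventually.of_forall fun n => M.norm_apply_le_of_norm_le_one (hf n) x)

theorem mem_cyclicSubspace_iff_tendsto {x z : X} : z ∈ M.cyclicSubspace x ↔
    ∃ f : ℕ → C(K, ℂ), Tendsto (fun n => M.m (f n) x) atTop (𝓝 z) := by
  rw [mem_cyclicSubspace_iff]
  constructor
  · intro hz
    obtain ⟨w, hw, hlim⟩ := mem_closure_iff_seq_limit.1 hz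
    choose f hfw using hw
    exact ⟨f, by simpa only [hfw] using hlim⟩
  · rintro ⟨f, hlim⟩
    exact mem_closure_of_tendsto hlim (Eventually.of_forall fun n => ⟨f n, rfl⟩)

theorem Delta_subset_cyclicSubspace {x z : X} (h : z ∈ M.Delta x) : z ∈ M.cyclicSubspace x := by
  obtain ⟨f, -, hlim⟩ := M.mem_Delta_iff.1 h
  exact M.mem_cyclicSubspace_iff_tendsto.2 ⟨f, hlim⟩

/-- As `y ∈ Δ(y + z)`, there are `a_n` in the unit ball with `a_n (y + z) → y`. If `v` is the limit
of `a_n y`, then `(1 - a_n) y` and `a_n z` have the same limit `y - v`, a multiple of a vector in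
`Δ(y) ∩ Δ(z)`, hence zero. -/
theorem DDisjoint.separated [CompleteSpace X] {M : BanachCKModule K X} {y z : X}
    (h : M.DDisjoint y z) : M.Separated y z := by
  obtain ⟨hsum, hinter⟩ := h
  have hy : y ∈ M.Delta (y + z) := by
    rw [hsum]; exact ⟨y, M.self_mem_Delta y, 0, M.zero_mem_Delta z, add_zero y⟩
  obtain ⟨a, ha, hlim⟩ := M.mem_Delta_iff.1 hy
  have hak : ∀ n k, ‖a n k‖ ≤ 1 := fun n k => ((a n).norm_coe_le_norm k).trans (ha n)
  -- Squares have increments `(a_n + a_m)(a_n - a_m)`, so `a_n² (y + z)` converges; its limit is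
  -- also that of `a_n y`.
  obtain ⟨v, hv⟩ := M.exists_tendsto_apply (g := fun n => a n * a n) 2 (fun n m k => by
    change ‖a n k * a n k - a m k * a m k‖ ≤ _
    rw [show a n k * a n k - a m k * a m k = (a n k + a m k) * (a n k - a m k) by ring, norm_mul]
    gcongr
    linarith [norm_add_le (a n k) (a m k), hak n k, hak m k]) hlim
  have hd : Tendsto (fun n => ‖M.m (a n) (y + z) - y‖) atTop (𝓝 0) := by
    simpa using (hlim.sub_const y).norm
  have hay : Tendsto (fun n => M.m (a n) y) atTop (𝓝 v) := by
    have h1 : Tendsto (fun n => M.m (a n) (M.m (a n) (y + z) - y)) atTop (𝓝 0) :=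
      squeeze_zero_norm (fun n => M.norm_apply_le_of_norm_le_one (ha n) _) hd
    have h2 := hv.sub h1
    simpa [map_mul] using h2
  have haz : Tendsto (fun n => M.m (a n) z) atTop (𝓝 (y - v)) := by
    have h2 := hlim.sub hay
    simpa using h2
  have hay' : Tendsto (fun n => M.m (1 - a n) y) atTop (𝓝 (y - v)) := by
    simpa using hay.const_sub y
  -- The factor `1/2` brings `1 - a_n`, of norm at most `2`, into the unit ball.
  have hhalf : (1 / 2 : ℂ) • (y - v) ∈ M.Delta y ∩ M.Delta z := by
    refine ⟨M.mem_Delta_iff.2 ⟨fun n => (1 / 2 : ℂ) • (1 - a n), fun n => ?_, ?_⟩,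
      M.mem_Delta_iff.2 ⟨fun n => (1 / 2 : ℂ) • a n, fun n => ?_, ?_⟩⟩
    · refine (ContinuousMap.norm_le _ zero_le_one).2 fun k => ?_
      have := norm_sub_le (1 : ℂ) (a n k)
      have := hak n k
      simp only [ContinuousMap.smul_apply, ContinuousMap.sub_apply, ContinuousMap.one_apply,
        norm_smul]
      norm_num at *
      linarith
    · simpa only [map_smul, smul_apply] using hay'.const_smul (1 / 2 : ℂ)
    · rw [norm_smul]; norm_num; linarith [ha n]
    · simpa only [map_smul, smul_apply] using haz.const_smul (1 / 2 : ℂ)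
  rw [hinter] at hhalf
  have hv0 : y - v = 0 := by simpa using hhalf
  rw [hv0] at hay' haz
  intro ε hε
  have e1 := hay'.norm.eventually (gt_mem_nhds (by simpa using hε))
  have e2 := haz.norm.eventually (gt_mem_nhds (by simpa using hε))
  obtain ⟨n, hn1, hn2⟩ := (e1.and e2).exists
  -- The complex `a_n` may be replaced by `|a_n|`, because `|1 - |a_n|| ≤ |1 - a_n|`.
  refine ⟨modulus (a n), fun k => norm_nonneg (a n k), hak n, lt_of_le_of_lt ?_ hn1,
    lt_of_le_of_lt ?_ hn2⟩
  · refine M.norm_apply_mono (fun k => ?_) y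
    simp only [ofReal_apply, Complex.norm_real, ContinuousMap.sub_apply, ContinuousMap.one_apply,
      modulus_apply, Real.norm_eq_abs]
    simpa using abs_norm_sub_norm_le (1 : ℂ) (a n k)
  · exact M.norm_apply_mono (fun k => by simp) z

/-- `f y + g z` is approximated by `(f a + g (1 - a)) (y + z)`, whose coefficient is a pointwise
convex combination and stays in the unit ball. -/
theorem Separated.add_mem_Delta {M : BanachCKModule K X} {y z u v : X} (h : M.Separated y z)
    (hu : u ∈ M.Delta y) (hv : v ∈ M.Delta z) : u + v ∈ M.Delta (y + z) := by
  have base : ∀ f g : C(K, ℂ), ‖f‖ ≤ 1 → ‖g‖ ≤ 1 → M.m f y + M.m g z ∈ M.Delta (y + z) := by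
    intro f g hf hg
    refine Metric.mem_closure_iff.2 fun ε hε => ?_
    obtain ⟨a, ha0, ha1, hy, hz⟩ := h (ε / 4) (by positivity)
    refine ⟨_, ⟨f * ofReal a + g * ofReal (1 - a), ?_, rfl⟩, ?_⟩
    · refine (ContinuousMap.norm_le _ zero_le_one).2 fun k => ?_
      have h1 := (f.norm_coe_le_norm k).trans hf
      have h2 := (g.norm_coe_le_norm k).trans hg
      have h3 : 0 ≤ 1 - a k := by linarith [ha1 k]
      calc ‖f k * (a k : ℂ) + g k * ((1 - a k : ℝ) : ℂ)‖
          ≤ ‖f k‖ * a k + ‖g k‖ * (1 - a k) := by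
            refine (norm_add_le _ _).trans_eq ?_
            rw [norm_mul, norm_mul, Complex.norm_real, Complex.norm_real,
              Real.norm_of_nonneg (ha0 k), Real.norm_of_nonneg h3]
        _ ≤ 1 * a k + 1 * (1 - a k) := by
            have := ha0 k
            gcongr
        _ = 1 := by ring
    · have e : M.m f y + M.m g z - M.m (f * ofReal a + g * ofReal (1 - a)) (y + z)
          = M.m (f - g) (M.realOrbit y (1 - a)) - M.m (f - g) (M.realOrbit z a) := by
        simp only [realOrbit_one_sub]
        simp only [map_add, map_mul, map_sub, add_apply, sub_apply, mul_apply_eq_comp,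
          ← realOrbit_apply, realOrbit_one]
        abel
      have hfg : ‖f - g‖ ≤ 2 := by linarith [norm_sub_le f g]
      rw [dist_eq_norm, e]
      calc _ ≤ ‖M.m (f - g) (M.realOrbit y (1 - a))‖ + ‖M.m (f - g) (M.realOrbit z a)‖ :=
            norm_sub_le _ _
        _ ≤ 2 * ‖M.realOrbit y (1 - a)‖ + 2 * ‖M.realOrbit z a‖ := by
            gcongr <;> refine (M.norm_apply_le _ _).trans ?_ <;> gcongr
        _ < ε := by linarith
  have hcl : u + v ∈ closure (M.Delta (y + z)) := by
    refine map_mem_closure₂ continuous_add hu hv ?_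
    rintro _ ⟨f, hf, rfl⟩ _ ⟨g, hg, rfl⟩
    exact base f g hf hg
  rwa [Delta, closure_closure] at hcl

/-- `f y` is nearly `a f (y + z)`. Consequently `f_n y` converges whenever `f_n (y + z)` does. -/
theorem Separated.norm_apply_left_le {M : BanachCKModule K X} {y z : X} (h : M.Separated y z)
    (f : C(K, ℂ)) : ‖M.m f y‖ ≤ ‖M.m f (y + z)‖ := by
  refine le_of_forall_pos_le_add fun ε hε => ?_
  obtain ⟨a, ha0, ha1, hy, hz⟩ := h (ε / (2 * (‖f‖ + 1))) (by positivity)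
  have e : M.m f y = M.m (ofReal a) (M.m f (y + z)) + M.m f (M.realOrbit y (1 - a))
      - M.m f (M.realOrbit z a) := by
    rw [realOrbit_one_sub, ← apply_mul, mul_comm, apply_mul, ← realOrbit_apply]
    simp only [map_add, map_sub, realOrbit_apply]
    abel
  have ha : ‖ofReal a‖ ≤ 1 := norm_ofReal_le_one fun k => by
    rw [abs_of_nonneg (ha0 k)]; exact ha1 k
  have b : ∀ w : X, ‖w‖ < ε / (2 * (‖f‖ + 1)) → ‖M.m f w‖ ≤ ε / 2 := by
    intro w hw
    refine (M.norm_apply_le f w).trans ?_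
    rw [lt_div_iff₀ (by positivity)] at hw
    nlinarith [norm_nonneg w, norm_nonneg f]
  calc ‖M.m f y‖ ≤ ‖M.m (ofReal a) (M.m f (y + z))‖ + ‖M.m f (M.realOrbit y (1 - a))‖
        + ‖M.m f (M.realOrbit z a)‖ := by
        conv_lhs => rw [e]
        exact (norm_sub_le _ _).trans (by gcongr; exact norm_add_le _ _)
    _ ≤ ‖M.m f (y + z)‖ + ε / 2 + ε / 2 := by
        gcongr
        · exact M.norm_apply_le_of_norm_le_one ha _
        · exact b _ hy
        · exact b _ hz
    _ = ‖M.m f (y + z)‖ + ε := by ring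

theorem Separated.dDisjoint [CompleteSpace X] {M : BanachCKModule K X} {y z : X}
    (h : M.Separated y z) : M.DDisjoint y z := by
  refine ⟨Set.Subset.antisymm ?_ ?_, Set.Subset.antisymm ?_ ?_⟩
  · intro w hw
    obtain ⟨f, hf, hlim⟩ := M.mem_Delta_iff.1 hw
    have hc : CauchySeq fun n => M.m (f n) y := by
      have hc := hlim.cauchySeq
      rw [Metric.cauchySeq_iff] at hc ⊢
      intro ε hε
      obtain ⟨n₀, hn₀⟩ := hc ε hε
      refine ⟨n₀, fun m hm n hn => ?_⟩
      have h1 := hn₀ m hm n hn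
      rw [dist_eq_norm, ← sub_apply, ← map_sub] at h1 ⊢
      exact (h.norm_apply_left_le _).trans_lt h1
    obtain ⟨u, hu⟩ := cauchySeq_tendsto_of_complete hc
    refine ⟨u, M.mem_Delta_iff.2 ⟨f, hf, hu⟩, w - u, M.mem_Delta_iff.2 ⟨f, hf, ?_⟩, by simp⟩
    simpa using hlim.sub hu
  · rintro _ ⟨u, hu, v, hv, rfl⟩
    exact h.add_mem_Delta hu hv
  · rintro u ⟨huy, huz⟩
    obtain ⟨f, hf, hfu⟩ := M.mem_Delta_iff.1 huy
    obtain ⟨g, hg, hgu⟩ := M.mem_Delta_iff.1 huz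
    have hle : ∀ ε : ℝ, 0 < ε → ‖u‖ ≤ 0 + ε := by
      intro ε hε
      obtain ⟨a, ha0, ha1, hy, hz⟩ := h (ε / 2) (by positivity)
      -- In the limit the left side becomes `‖(1 - a) u + a u‖ = ‖u‖`.
      have h1 : ∀ n, ‖M.m (ofReal (1 - a)) (M.m (f n) y) + M.m (ofReal a) (M.m (g n) z)‖ ≤ ε := by
        intro n
        rw [← apply_mul, ← apply_mul, mul_comm, mul_comm (ofReal a), apply_mul, apply_mul]
        refine (norm_add_le _ _).trans ?_
        have h2 := M.norm_apply_le_of_norm_le_one (hf n) (M.m (ofReal (1 - a)) y)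
        have h3 := M.norm_apply_le_of_norm_le_one (hg n) (M.m (ofReal a) z)
        rw [realOrbit_apply] at hy hz
        linarith
      have h2 := le_of_tendsto ((((M.m (ofReal (1 - a))).continuous.tendsto u).comp hfu).add
        (((M.m (ofReal a)).continuous.tendsto u).comp hgu)).norm (Eventually.of_forall h1)
      rw [← realOrbit_apply, ← realOrbit_apply, ← map_add, sub_add_cancel, realOrbit_one] at h2
      linarith
    simpa using le_of_forall_pos_le_add hle
  · rintro _ rfl
    exact ⟨M.zero_mem_Delta y, M.zero_mem_Delta z⟩

theorem dDisjoint_iff_separated [CompleteSpace X] {y z : X} :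
    M.DDisjoint y z ↔ M.Separated y z :=
  ⟨DDisjoint.separated, Separated.dDisjoint⟩

end Separated

/-! ### Layers of a real function. -/

section Functions

variable {K : Type*} [TopologicalSpace K]

/-- The truncation of `c f - j` to the interval `[0, 1]`. -/
noncomputable def ramp (f : C(K, ℝ)) (c : ℝ) (j : ℕ) : C(K, ℝ) :=
  ⟨fun k => max 0 (min 1 (c * f k - j)), by fun_prop⟩

theorem ramp_apply (f : C(K, ℝ)) (c : ℝ) (j : ℕ) (k : K) :
    ramp f c j k = max 0 (min 1 (c * f k - j)) := rfl

theorem ramp_nonneg (f : C(K, ℝ)) (c : ℝ) (j : ℕ) (k : K) : 0 ≤ ramp f c j k := le_max_left _ _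

theorem ramp_le_one (f : C(K, ℝ)) (c : ℝ) (j : ℕ) (k : K) : ramp f c j k ≤ 1 :=
  max_le zero_le_one (min_le_left _ _)

theorem ramp_antitone (f : C(K, ℝ)) (c : ℝ) (k : K) : Antitone fun j => ramp f c j k := by
  intro i j hij
  have : (i : ℝ) ≤ j := by exact_mod_cast hij
  simp only [ramp_apply]
  gcongr

theorem sum_ramp (f : C(K, ℝ)) (hf0 : ∀ k, 0 ≤ f k) (c : ℝ) (hc : 0 ≤ c) (n : ℕ) (k : K) :
    ∑ j ∈ Finset.range n, ramp f c j k = min (n : ℝ) (c * f k) := by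
  induction n with
  | zero => simpa using mul_nonneg hc (hf0 k)
  | succ n ih =>
    rw [Finset.sum_range_succ, ih, ramp_apply]
    push_cast
    rcases le_total (c * f k) n with h | h
    · rw [min_eq_right h, min_eq_right (by linarith), min_eq_right (by linarith),
        max_eq_left (by linarith), add_zero]
    · rw [min_eq_left h, max_eq_right (le_min zero_le_one (by linarith))]
      rcases le_total (c * f k) (n + 1) with h' | h'
      · rw [min_eq_right (by linarith), min_eq_right h']; ring
      · rw [min_eq_left (by linarith), min_eq_left h']

/-- Consecutive differences of the functions `ramp f c j`. -/
noncomputable def bump (f : C(K, ℝ)) (c : ℝ) (j : ℕ) : C(K, ℝ) := ramp f c j - ramp f c (j + 1)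

theorem bump_nonneg (f : C(K, ℝ)) (c : ℝ) (j : ℕ) (k : K) : 0 ≤ bump f c j k :=
  sub_nonneg.2 (ramp_antitone f c k (Nat.le_succ j))

/-- `bump f c i` is nonzero only where `i < c f < i + 2`. Neighbouring bumps overlap, hence the
later split by parity. -/
theorem bump_mul_bump (f : C(K, ℝ)) (c : ℝ) {i j : ℕ} (h : i + 2 ≤ j) :
    bump f c i * bump f c j = 0 := by
  ext k
  have hij : (i : ℝ) + 2 ≤ j := by exact_mod_cast h
  simp only [bump, ContinuousMap.mul_apply, ContinuousMap.sub_apply, ramp_apply,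
    ContinuousMap.zero_apply]
  push_cast
  rcases le_total (c * f k) j with hk | hk
  · rw [max_eq_left (b := min 1 (c * f k - j)) ((min_le_right _ _).trans (by linarith)),
      max_eq_left (b := min 1 (c * f k - (j + 1))) ((min_le_right _ _).trans (by linarith))]
    ring
  · rw [min_eq_left (a := 1) (b := c * f k - i) (by linarith),
      min_eq_left (a := 1) (b := c * f k - (i + 1)) (by linarith)]
    ring

theorem ramp_mul_one_sub_ramp (f : C(K, ℝ)) (c : ℝ) (j : ℕ) :
    ramp f c (j + 1) * (1 - ramp f c j) = 0 := by
  ext k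
  simp only [ContinuousMap.mul_apply, ContinuousMap.sub_apply, ramp_apply,
    ContinuousMap.zero_apply, ContinuousMap.one_apply]
  push_cast
  rcases le_total (c * f k) (j + 1) with hk | hk
  · rw [max_eq_left (b := min 1 (c * f k - (j + 1))) ((min_le_right _ _).trans (by linarith)),
      zero_mul]
  · rw [min_eq_left (a := 1) (b := c * f k - j) (by linarith)]
    norm_num

/-- Enlarging each bump to a drop over two indices makes the sum telescope. -/
theorem sum_bump_le_one (f : C(K, ℝ)) (c : ℝ) (e n : ℕ) (k : K) :
    ∑ j ∈ Finset.range n, bump f c (2 * j + e) k ≤ 1 := by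
  calc ∑ j ∈ Finset.range n, bump f c (2 * j + e) k
      ≤ ∑ j ∈ Finset.range n, (ramp f c (2 * j + e) k - ramp f c (2 * (j + 1) + e) k) := by
        refine Finset.sum_le_sum fun j _ => ?_
        exact sub_le_sub_left (ramp_antitone f c k (by omega)) _
    _ = ramp f c e k - ramp f c (2 * n + e) k := by
        rw [Finset.sum_range_sub' (fun j => ramp f c (2 * j + e) k)]; simp
    _ ≤ 1 := by linarith [ramp_le_one f c e k, ramp_nonneg f c (2 * n + e) k]

end Functions

/-! ### Sums of vectors over disjoint functions. -/

section Sums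

variable {K L Y : Type*} [TopologicalSpace K] [TopologicalSpace L]
  [CompactSpace L] [NormedAddCommGroup Y] [NormedSpace ℂ Y] {N : BanachCKModule L Y}

theorem sum_range_two_mul {A : Type*} [AddCommMonoid A] (F : ℕ → A) (n : ℕ) :
    ∑ j ∈ Finset.range (2 * n), F j
      = ∑ j ∈ Finset.range n, F (2 * j + 0) + ∑ j ∈ Finset.range n, F (2 * j + 1) := by
  induction n with
  | zero => simp
  | succ n ih =>
    rw [mul_add, mul_one, Finset.sum_range_succ, Finset.sum_range_succ, ih,
      Finset.sum_range_succ, Finset.sum_range_succ]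
    simp only [add_zero]
    abel

/-- This bounds the norm of the sum by that of a single value of `S`, so the bound need not grow
with `n`. -/
theorem sum_mem_Delta_of_separated (S : C(K, ℝ) →ₗ[ℝ] Y)
    (hS : ∀ f g : C(K, ℝ), f * g = 0 → N.Separated (S f) (S g)) {p : ℕ → C(K, ℝ)}
    (hp : ∀ i j, i < j → p i * p j = 0) {u : ℕ → Y} (hu : ∀ j, u j ∈ N.Delta (S (p j))) (n : ℕ) :
    ∑ j ∈ Finset.range n, u j ∈ N.Delta (S (∑ j ∈ Finset.range n, p j)) := by
  induction n with
  | zero => simpa using N.zero_mem_Delta _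
  | succ n ih =>
    rw [Finset.sum_range_succ, Finset.sum_range_succ, map_add]
    refine (hS _ _ ?_).add_mem_Delta ih (hu n)
    rw [Finset.sum_mul]
    exact Finset.sum_eq_zero fun j hj => hp j n (Finset.mem_range.1 hj)

end Sums

/-! ### Images of functions lie in the cyclic subspace of the image of `1`. -/

section Localization

variable {K L Y : Type*} [TopologicalSpace K] [TopologicalSpace L] [CompactSpace L]
  [NormedAddCommGroup Y] [NormedSpace ℂ Y] (N : BanachCKModule L Y)

/-- A bounded operator that sends disjoint functions to separated vectors maps functions into the
cyclic subspace generated by the image of the constant function `1`. -/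
theorem map_mem_cyclicSubspace_of_unitInterval (S : C(K, ℝ) →ₗ[ℝ] Y) {C : ℝ}
    (hC : ∀ f : C(K, ℝ), (∀ k, |f k| ≤ 1) → ‖S f‖ ≤ C)
    (hS : ∀ f g : C(K, ℝ), f * g = 0 → N.Separated (S f) (S g))
    {f : C(K, ℝ)} (hf0 : ∀ k, 0 ≤ f k) (hf1 : ∀ k, f k ≤ 1) :
    S f ∈ N.cyclicSubspace (S 1) := by
  rw [mem_cyclicSubspace_iff, Metric.mem_closure_iff]
  intro ε hε
  -- With `c = 2n`, the final bound `2C + c ε / 2` is then below `c ε`.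
  obtain ⟨n, hn⟩ := exists_nat_gt (2 * C / ε)
  have hC0 : 0 ≤ C := (norm_nonneg _).trans (hC 0 (by simp))
  have hn0 : (0 : ℝ) < n := lt_of_le_of_lt (by positivity) hn
  set c : ℝ := ((2 * n : ℕ) : ℝ) with hc
  have hcn : c = 2 * n := by rw [hc]; push_cast; ring
  have hc0 : 0 < c := by rw [hcn]; positivity
  choose b hb0 hb1 hbr hbl using fun j =>
    hS _ _ (ramp_mul_one_sub_ramp f c j) (ε / 4) (by positivity)
  have hsum : c • f = ∑ j ∈ Finset.range (2 * n), ramp f c j := by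
    ext k
    rw [ContinuousMap.coe_sum, Finset.sum_apply, sum_ramp f hf0 c hc0.le, ← hc, min_eq_right]
    · rfl
    · nlinarith [hf1 k]
  have hpart : ∀ e, ‖∑ j ∈ Finset.range n,
      N.realOrbit (S (bump f c (2 * j + e))) (1 - b (2 * j + e))‖ ≤ C := by
    intro e
    refine (N.norm_le_of_mem_Delta (sum_mem_Delta_of_separated (N := N) S hS
      (p := fun j => bump f c (2 * j + e)) (fun i j hij => bump_mul_bump f c (by omega))
      (fun j => N.apply_mem_Delta (norm_ofReal_le_one fun k => ?_) _) n)).trans (hC _ fun k => ?_)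
    · rw [ContinuousMap.sub_apply, ContinuousMap.one_apply, abs_le]
      constructor <;> linarith [hb0 (2 * j + e) k, hb1 (2 * j + e) k]
    · rw [ContinuousMap.coe_sum, Finset.sum_apply,
        abs_of_nonneg (Finset.sum_nonneg fun j _ => bump_nonneg f c _ k)]
      exact sum_bump_le_one f c e n k
  -- Termwise, `S r_j - b_j S 1 = (1 - b_j) S r_j - b_j S(1 - r_j)`, and `r_j` is the bump plus
  -- `r_{j+1}`.
  have hdecomp : c • (S f - N.realOrbit (S 1) (c⁻¹ • ∑ j ∈ Finset.range (2 * n), b j))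
      = ∑ j ∈ Finset.range (2 * n), N.realOrbit (S (bump f c j)) (1 - b j)
        + ∑ j ∈ Finset.range (2 * n), (N.realOrbit (S (ramp f c (j + 1))) (1 - b j)
          - N.realOrbit (S (1 - ramp f c j)) (b j)) := by
    rw [smul_sub, ← map_smul, ← map_smul, smul_inv_smul₀ hc0.ne', hsum, map_sum, map_sum,
      ← Finset.sum_sub_distrib, ← Finset.sum_add_distrib]
    refine Finset.sum_congr rfl fun j _ => ?_
    simp only [realOrbit_one_sub]
    simp only [bump, map_sub, realOrbit_apply]
    abel
  refine ⟨_, ⟨ofReal (c⁻¹ • ∑ j ∈ Finset.range (2 * n), b j), rfl⟩, ?_⟩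
  rw [← realOrbit_apply, dist_eq_norm]
  have hle : c * ‖S f - N.realOrbit (S 1) (c⁻¹ • ∑ j ∈ Finset.range (2 * n), b j)‖
      ≤ (C + C) + c * (ε / 2) := by
    rw [← Real.norm_of_nonneg hc0.le, ← norm_smul, Real.norm_of_nonneg hc0.le, hdecomp]
    refine (norm_add_le _ _).trans (add_le_add ?_ ?_)
    · rw [sum_range_two_mul]
      exact (norm_add_le _ _).trans (add_le_add (hpart 0) (hpart 1))
    · refine (norm_sum_le_of_le _ (f := _) (n := fun _ => ε / 2) fun j _ => ?_).trans_eq ?_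
      · exact (norm_sub_le _ _).trans (by linarith [hbr j, hbl j])
      · rw [Finset.sum_const, Finset.card_range, nsmul_eq_mul]
  rw [div_lt_iff₀ hε] at hn
  have : c * ‖S f - N.realOrbit (S 1) (c⁻¹ • ∑ j ∈ Finset.range (2 * n), b j)‖ < c * ε := by
    refine hle.trans_lt ?_
    rw [hcn]
    linarith
  exact lt_of_mul_lt_mul_left this hc0.le

theorem map_mem_cyclicSubspace_of_separated [CompactSpace K] (S : C(K, ℝ) →ₗ[ℝ] Y) {C : ℝ}
    (hC : ∀ f : C(K, ℝ), (∀ k, |f k| ≤ 1) → ‖S f‖ ≤ C)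
    (hS : ∀ f g : C(K, ℝ), f * g = 0 → N.Separated (S f) (S g)) (f : C(K, ℝ)) :
    S f ∈ N.cyclicSubspace (S 1) := by
  set r : ℝ := ‖f‖ + 1 with hr
  have hr0 : 0 < r := by positivity
  have hfk : ∀ k, |f k| ≤ r := fun k => by
    have := f.norm_coe_le_norm k
    rw [Real.norm_eq_abs] at this
    linarith
  -- An affine change moves `f` into `[0, 1]` and alters `S f` only by scaling and a multiple of `S
  -- 1`.
  have h := N.map_mem_cyclicSubspace_of_unitInterval S hC hS (f := (2 * r)⁻¹ • (f + r • 1))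
    (fun k => ?_) (fun k => ?_)
  · have e : S f = ((2 * r : ℝ) : ℂ) • S ((2 * r)⁻¹ • (f + r • 1)) - ((r : ℝ) : ℂ) • S 1 := by
      rw [Complex.coe_smul, Complex.coe_smul, map_smul, smul_inv_smul₀ (by positivity), map_add,
        map_smul, add_sub_cancel_right]
    rw [e]
    refine Submodule.sub_mem _ (Submodule.smul_mem _ _ h) (Submodule.smul_mem _ _ ?_)
    exact N.Delta_subset_cyclicSubspace (N.self_mem_Delta _)
  · have := (abs_le.1 (hfk k)).1
    simp only [ContinuousMap.smul_apply, ContinuousMap.add_apply, ContinuousMap.one_apply,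
      smul_eq_mul, mul_one]
    exact mul_nonneg (by positivity) (by linarith)
  · have := (abs_le.1 (hfk k)).2
    simp only [ContinuousMap.smul_apply, ContinuousMap.add_apply, ContinuousMap.one_apply,
      smul_eq_mul, mul_one]
    rw [inv_mul_le_iff₀ (by positivity)]
    linarith

end Localization

/-! ### Operators preserving separation. -/

section Operators

variable {K L X Y : Type*} [TopologicalSpace K] [CompactSpace K] [TopologicalSpace L]
  [CompactSpace L] [NormedAddCommGroup X] [NormedSpace ℂ X] [NormedAddCommGroup Y]
  [NormedSpace ℂ Y] (M : BanachCKModule K X) (N : BanachCKModule L Y)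

theorem separated_realOrbit {f g : C(K, ℝ)} (h : f * g = 0) (x : X) :
    M.Separated (M.realOrbit x f) (M.realOrbit x g) := by
  intro ε hε
  set δ : ℝ := ε / (‖x‖ + 1) with hδ
  have hδ0 : 0 < δ := by positivity
  have hδx : δ * ‖x‖ < ε := by
    rw [hδ, div_mul_eq_mul_div, div_lt_iff₀ (by positivity)]
    linarith
  have hpos : ∀ k, 0 < |f k| + |g k| + δ := fun k => by positivity
  have small : ∀ (s r : C(K, ℝ)), (∀ k, |s k * r k| ≤ δ) →
      ‖M.realOrbit (M.realOrbit x r) s‖ < ε := by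
    intro s r hsr
    have e : M.realOrbit (M.realOrbit x r) s = M.m (ofReal (s * r)) x := by
      rw [realOrbit_apply, realOrbit_apply, ← apply_mul]
      congr 2; ext k; simp
    rw [e]
    refine ((M.norm_apply_le _ _).trans ?_).trans_lt hδx
    gcongr
    exact (ContinuousMap.norm_le _ hδ0.le).2 fun k => by simpa using hsr k
  -- Where `g = 0`, `(1 - a)|f| = δ|f| / (|f| + δ) ≤ δ`; where `f = 0`, `a = 0`.
  refine ⟨⟨fun k => |f k| / (|f k| + |g k| + δ),
    Continuous.div (by fun_prop) (by fun_prop) fun k => (hpos k).ne'⟩, fun k => ?_, fun k => ?_,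
    small _ _ fun k => ?_, small _ _ fun k => ?_⟩
  · exact div_nonneg (abs_nonneg _) (hpos k).le
  · exact (div_le_one (hpos k)).2 (by linarith [abs_nonneg (g k)])
  · change |(1 - |f k| / (|f k| + |g k| + δ)) * f k| ≤ δ
    rcases mul_eq_zero.1 (DFunLike.congr_fun h k : f k * g k = 0) with h0 | h0
    · simp [h0, hδ0.le]
    · have hp := hpos k
      rw [h0, abs_zero, add_zero] at hp ⊢
      rw [one_sub_div hp.ne', abs_mul, abs_div, abs_of_pos hp, add_sub_cancel_left,
        abs_of_pos hδ0, div_mul_eq_mul_div, div_le_iff₀ hp]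
      nlinarith [abs_nonneg (f k)]
  · change |(|f k| / (|f k| + |g k| + δ)) * g k| ≤ δ
    rcases mul_eq_zero.1 (DFunLike.congr_fun h k : f k * g k = 0) with h0 | h0 <;>
      simp [h0, hδ0.le]

theorem map_mem_cyclicSubspace (T : X →L[ℂ] Y)
    (hT : ∀ x y : X, M.Separated x y → N.Separated (T x) (T y)) {x z : X}
    (hz : z ∈ M.cyclicSubspace x) : T z ∈ N.cyclicSubspace (T x) := by
  have hclosed : IsClosed (N.cyclicSubspace (T x) : Set Y) :=
    Submodule.isClosed_topologicalClosure _
  let S : C(K, ℝ) →ₗ[ℝ] Y := (T.toLinearMap.restrictScalars ℝ) ∘ₗ M.realOrbit x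
  have hS1 : S 1 = T x := congrArg T (M.realOrbit_one x)
  have hreal : ∀ r : C(K, ℝ), T (M.realOrbit x r) ∈ N.cyclicSubspace (T x) := by
    intro r
    rw [← hS1]
    refine N.map_mem_cyclicSubspace_of_separated S (C := ‖T‖ * ‖x‖) (fun f hf => ?_)
      (fun f g hfg => hT _ _ (M.separated_realOrbit hfg x)) r
    exact (T.le_opNorm _).trans (by gcongr; exact M.norm_realOrbit_le hf x)
  obtain ⟨f, hlim⟩ := M.mem_cyclicSubspace_iff_tendsto.1 hz
  refine hclosed.mem_of_tendsto ((T.continuous.tendsto z).comp hlim) (Eventually.of_forall ?_)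
  intro n
  have e : f n = ofReal ⟨fun k => (f n k).re, by fun_prop⟩
      + Complex.I • ofReal ⟨fun k => (f n k).im, by fun_prop⟩ := by
    ext k
    simpa [mul_comm] using (Complex.re_add_im (f n k)).symm
  change T (M.m (f n) x) ∈ _
  rw [e, map_add, map_smul, add_apply, smul_apply, map_add, map_smul]
  exact Submodule.add_mem _ (hreal _) (Submodule.smul_mem _ _ (hreal _))

end Operators

/-! ### Real and imaginary parts, and rotations. -/

section Parts

variable {K : Type*} [TopologicalSpace K]

/-- The real part of a complex-valued continuous function. -/
noncomputable def rePart (f : C(K, ℂ)) : C(K, ℝ) := ⟨fun k => (f k).re, by fun_prop⟩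

/-- The imaginary part of a complex-valued continuous function. -/
noncomputable def imPart (f : C(K, ℂ)) : C(K, ℝ) := ⟨fun k => (f k).im, by fun_prop⟩

theorem ofReal_rePart_add (f : C(K, ℂ)) :
    ofReal (rePart f) + Complex.I • ofReal (imPart f) = f := by
  ext k
  simpa [rePart, imPart, mul_comm] using Complex.re_add_im (f k)

theorem rePart_ofReal_add (g h : C(K, ℝ)) : rePart (ofReal g + Complex.I • ofReal h) = g := by
  ext k
  simp [rePart]

theorem imPart_ofReal_add (g h : C(K, ℝ)) : imPart (ofReal g + Complex.I • ofReal h) = h := by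
  ext k
  simp [imPart]

theorem cos_mul_re_add_sin_mul_im_le_norm (θ : ℝ) (z : ℂ) :
    Real.cos θ * z.re + Real.sin θ * z.im ≤ ‖z‖ := by
  refine le_of_sq_le_sq ?_ (norm_nonneg z)
  rw [Complex.sq_norm, Complex.normSq_apply]
  nlinarith [Real.sin_sq_add_cos_sq θ, sq_nonneg (Real.cos θ * z.im - Real.sin θ * z.re)]

/-- A finite net of angles serves every `z`, with relative error `δ`. It is needed because limits
are available for each `θ` separately, not uniformly in `θ`. -/
theorem exists_finset_norm_le_cos_mul_re_add_sin_mul_im {δ : ℝ} (hδ : 0 < δ) :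
    ∃ s : Finset ℝ, ∀ z : ℂ, ∃ θ ∈ s,
      ‖z‖ ≤ Real.cos θ * z.re + Real.sin θ * z.im + δ * ‖z‖ := by
  have hη : 0 < min δ 1 := lt_min hδ one_pos
  obtain ⟨t, -, ht, hcover⟩ := (isCompact_Icc (a := -Real.pi) (b := Real.pi)).finite_cover_balls hη
  refine ⟨ht.toFinset, fun z => ?_⟩
  obtain ⟨θ, hθ, hd⟩ := Set.mem_iUnion₂.1
    (hcover ⟨(Complex.neg_pi_lt_arg z).le, Complex.arg_le_pi z⟩)
  refine ⟨θ, ht.mem_toFinset.2 hθ, ?_⟩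
  rw [Metric.mem_ball, Real.dist_eq] at hd
  have h1 := Real.one_sub_sq_div_two_le_cos (x := z.arg - θ)
  have h2 : (z.arg - θ) ^ 2 ≤ δ := by
    rw [← sq_abs]
    nlinarith [abs_nonneg (z.arg - θ), min_le_left δ 1, min_le_right δ 1]
  have e : Real.cos θ * z.re + Real.sin θ * z.im = ‖z‖ * Real.cos (z.arg - θ) := by
    rw [Real.cos_sub]
    conv_lhs => rw [← Complex.norm_mul_cos_arg z, ← Complex.norm_mul_sin_arg z]
    ring
  rw [e]
  nlinarith [norm_nonneg z]

end Parts

/-! ### Order, modulus and disjointness in `X(x)` via representing sequences. -/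

section CyclicLattice

variable {K X : Type*} [TopologicalSpace K] [CompactSpace K]
  [NormedAddCommGroup X] [NormedSpace ℂ X] {M : BanachCKModule K X} {x y z : X}

theorem mem_cyclicCone_iff_tendsto : z ∈ M.cyclicCone x ↔
    ∃ r : ℕ → C(K, ℝ), (∀ n k, 0 ≤ r n k) ∧
      Tendsto (fun n => M.realOrbit x (r n)) atTop (𝓝 z) := by
  constructor
  · intro hz
    obtain ⟨w, hw, hlim⟩ := mem_closure_iff_seq_limit.1 hz
    choose f hf hfw using hw
    refine ⟨fun n => rePart (f n), fun n k => (Complex.le_def.1 (hf n k)).1, ?_⟩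
    have e : ∀ n, M.realOrbit x (rePart (f n)) = w n := fun n => by
      rw [← hfw n, realOrbit_apply]
      congr 2
      ext k
      exact (Complex.eq_re_of_ofReal_le (r := 0) (by simpa using hf n k)).symm
    simpa only [e] using hlim
  · rintro ⟨r, hr, hlim⟩
    refine mem_closure_of_tendsto hlim (Eventually.of_forall fun n => ⟨ofReal (r n), ?_, rfl⟩)
    intro k
    exact Complex.zero_le_real.2 (hr n k)

/-- If `s_n ≥ 0` represents the same vector, the negative part of `r_n` is at most `|r_n - s_n|`.
Positivity can thus be tested on any representing sequence. -/
theorem tendsto_realOrbit_negPart {r : ℕ → C(K, ℝ)}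
    (hr : Tendsto (fun n => M.realOrbit x (r n)) atTop (𝓝 z)) (hz : z ∈ M.cyclicCone x) :
    Tendsto (fun n => M.realOrbit x (-r n ⊔ 0)) atTop (𝓝 0) := by
  obtain ⟨s, hs, hlim⟩ := mem_cyclicCone_iff_tendsto.1 hz
  have h0 : Tendsto (fun n => ‖M.realOrbit x (r n - s n)‖) atTop (𝓝 0) := by
    simpa using (hr.sub hlim).norm
  refine squeeze_zero_norm (fun n => M.norm_realOrbit_mono (fun k => ?_) x) h0
  change |max (-r n k) 0| ≤ |r n k - s n k|
  rw [abs_of_nonneg (le_max_right _ _)]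
  refine max_le ?_ (abs_nonneg _)
  linarith [neg_le_abs (r n k - s n k), hs n k]

theorem mem_cyclicCone_of_tendsto_negPart {r : ℕ → C(K, ℝ)}
    (hr : Tendsto (fun n => M.realOrbit x (r n)) atTop (𝓝 z))
    (hn : Tendsto (fun n => M.realOrbit x (-r n ⊔ 0)) atTop (𝓝 0)) : z ∈ M.cyclicCone x := by
  refine mem_cyclicCone_iff_tendsto.2 ⟨fun n => r n + (-r n ⊔ 0), fun n k => ?_, ?_⟩
  · change 0 ≤ r n k + max (-r n k) 0
    linarith [le_max_left (-r n k) 0]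
  · simpa using hr.add hn

theorem exists_tendsto_realOrbit [CompleteSpace X] {r s : ℕ → C(K, ℝ)}
    (h : ∀ n m k, |s n k - s m k| ≤ |r n k - r m k|)
    (hr : Tendsto (fun n => M.realOrbit x (r n)) atTop (𝓝 z)) :
    ∃ w, Tendsto (fun n => M.realOrbit x (s n)) atTop (𝓝 w) := by
  refine M.exists_tendsto_apply (g := fun n => ofReal (s n)) 1 (fun n m k => ?_) hr
  rw [one_mul, ofReal_apply, ofReal_apply, ofReal_apply, ofReal_apply, ← Complex.ofReal_sub,
    ← Complex.ofReal_sub, Complex.norm_real, Complex.norm_real]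
  exact h n m k

theorem mem_cyclicReal_iff_tendsto [CompleteSpace X] : z ∈ M.cyclicReal x ↔
    ∃ r : ℕ → C(K, ℝ), Tendsto (fun n => M.realOrbit x (r n)) atTop (𝓝 z) := by
  constructor
  · rintro ⟨a, ha, b, hb, rfl⟩
    obtain ⟨r, -, hr⟩ := mem_cyclicCone_iff_tendsto.1 ha
    obtain ⟨s, -, hs⟩ := mem_cyclicCone_iff_tendsto.1 hb
    exact ⟨fun n => r n - s n, by simpa using hr.sub hs⟩
  · rintro ⟨r, hr⟩
    obtain ⟨p, hp⟩ := exists_tendsto_realOrbit (s := fun n => r n ⊔ 0)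
      (fun n m k => abs_max_sub_max_le_abs _ _ 0) hr
    refine ⟨p, mem_cyclicCone_iff_tendsto.2 ⟨_, fun n k => le_max_right _ _, hp⟩, p - z,
      mem_cyclicCone_iff_tendsto.2 ⟨fun n => (r n ⊔ 0) - r n, fun n k => ?_, ?_⟩, by simp⟩
    · change 0 ≤ max (r n k) 0 - r n k
      linarith [le_max_left (r n k) 0]
    · simpa using hp.sub hr

theorem CyclicReal.exists_tendsto [CompleteSpace X] (u : M.CyclicReal x) :
    ∃ r : ℕ → C(K, ℝ), Tendsto (fun n => M.realOrbit x (r n)) atTop (𝓝 (CyclicReal.incl u)) :=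
  mem_cyclicReal_iff_tendsto.1 (Subtype.property u)

theorem CyclicReal.exists_incl_eq [CompleteSpace X] {r : ℕ → C(K, ℝ)}
    (hr : Tendsto (fun n => M.realOrbit x (r n)) atTop (𝓝 z)) :
    ∃ u : M.CyclicReal x, CyclicReal.incl u = z :=
  ⟨⟨z, mem_cyclicReal_iff_tendsto.2 ⟨r, hr⟩⟩, rfl⟩

theorem CyclicReal.le_iff {u v : M.CyclicReal x} :
    u ≤ v ↔ CyclicReal.incl v - CyclicReal.incl u ∈ M.cyclicCone x := Iff.rfl

theorem isLUB_of_tendsto_modulus [CompleteSpace X] {f : ℕ → C(K, ℂ)} {u v a : M.CyclicReal x}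
    (hu : Tendsto (fun n => M.realOrbit x (rePart (f n))) atTop (𝓝 (CyclicReal.incl u)))
    (hv : Tendsto (fun n => M.realOrbit x (imPart (f n))) atTop (𝓝 (CyclicReal.incl v)))
    (ha : Tendsto (fun n => M.realOrbit x (modulus (f n))) atTop (𝓝 (CyclicReal.incl a))) :
    IsLUB (Set.range fun θ : ℝ => Real.cos θ • u + Real.sin θ • v) a := by
  have hrot : ∀ θ : ℝ, Tendsto (fun n => M.realOrbit x
      (Real.cos θ • rePart (f n) + Real.sin θ • imPart (f n))) atTop
      (𝓝 (CyclicReal.incl (Real.cos θ • u + Real.sin θ • v))) := fun θ => by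
    simpa only [map_add, map_smul] using (hu.const_smul _).add (hv.const_smul _)
  constructor
  · rintro _ ⟨θ, rfl⟩
    rw [CyclicReal.le_iff]
    refine mem_cyclicCone_iff_tendsto.2 ⟨_, fun n k => ?_, by
      simpa only [← map_sub] using ha.sub (hrot θ)⟩
    exact sub_nonneg.2 (cos_mul_re_add_sin_mul_im_le_norm θ (f n k))
  · intro b hb
    rw [CyclicReal.le_iff]
    obtain ⟨t, ht⟩ := b.exists_tendsto
    have hta : Tendsto (fun n => M.realOrbit x (t n - modulus (f n))) atTop
        (𝓝 (CyclicReal.incl b - CyclicReal.incl a)) := by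
      simpa only [map_sub] using ht.sub ha
    refine mem_cyclicCone_of_tendsto_negPart hta ?_
    -- The amount by which `t_n` fails to dominate the rotation by `θ`. Over a finite net, `(|f_n| -
    -- t_n)⁺ ≤ ∑ d_θ + δ |f_n|`.
    let d : ℝ → ℕ → C(K, ℝ) := fun θ n =>
      -(t n - (Real.cos θ • rePart (f n) + Real.sin θ • imPart (f n))) ⊔ 0
    have hd : ∀ θ, Tendsto (fun n => M.realOrbit x (d θ n)) atTop (𝓝 0) := fun θ =>
      tendsto_realOrbit_negPart (by simpa only [map_sub] using ht.sub (hrot θ))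
        (CyclicReal.le_iff.1 (hb ⟨θ, rfl⟩))
    have hd0 : ∀ θ n k, 0 ≤ d θ n k := fun θ n k => le_max_right _ _
    rw [Metric.tendsto_nhds]
    intro ε hε
    set δ : ℝ := ε / (‖CyclicReal.incl a‖ + 1) with hδ
    have hδ0 : 0 < δ := by positivity
    obtain ⟨s, hs⟩ := exists_finset_norm_le_cos_mul_re_add_sin_mul_im hδ0
    have hlim : Tendsto (fun n => (∑ θ ∈ s, ‖M.realOrbit x (d θ n)‖)
        + δ * ‖M.realOrbit x (modulus (f n))‖) atTop
        (𝓝 ((∑ θ ∈ s, ‖(0 : X)‖) + δ * ‖CyclicReal.incl a‖)) :=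
      (tendsto_finsetSum s fun θ _ => (hd θ).norm).add (ha.norm.const_mul δ)
    have hlt : (∑ θ ∈ s, ‖(0 : X)‖) + δ * ‖CyclicReal.incl a‖ < ε := by
      rw [norm_zero, Finset.sum_const_zero, zero_add, hδ, div_mul_eq_mul_div,
        div_lt_iff₀ (by positivity)]
      linarith
    filter_upwards [hlim.eventually (gt_mem_nhds hlt)] with n hn
    rw [dist_zero_right]
    refine lt_of_le_of_lt ?_ hn
    calc ‖M.realOrbit x (-(t n - modulus (f n)) ⊔ 0)‖
        ≤ ‖M.realOrbit x ((∑ θ ∈ s, d θ n) + δ • modulus (f n))‖ := by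
          refine M.norm_realOrbit_mono (fun k => ?_) x
          refine le_trans ?_ (le_abs_self _)
          change |max (-(t n k - ‖f n k‖)) 0| ≤ (∑ θ ∈ s, d θ n) k + δ * ‖f n k‖
          rw [abs_of_nonneg (le_max_right _ _), ContinuousMap.coe_sum, Finset.sum_apply]
          have hsum0 : 0 ≤ ∑ θ ∈ s, d θ n k := Finset.sum_nonneg fun θ _ => hd0 θ n k
          refine max_le ?_ (by positivity)
          obtain ⟨θ, hθ, hle⟩ := hs (f n k)
          have h1 : d θ n k ≤ ∑ θ ∈ s, d θ n k :=
            Finset.single_le_sum (fun θ _ => hd0 θ n k) hθ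
          have h2 : -(t n k - (Real.cos θ * (f n k).re + Real.sin θ * (f n k).im)) ≤ d θ n k :=
            le_max_left _ _
          linarith
      _ ≤ (∑ θ ∈ s, ‖M.realOrbit x (d θ n)‖) + δ * ‖M.realOrbit x (modulus (f n))‖ := by
          rw [map_add, map_sum, map_smul]
          refine (norm_add_le _ _).trans (add_le_add (norm_sum_le _ _) ?_)
          rw [norm_smul, Real.norm_of_nonneg hδ0.le]

theorem exists_tendsto_modulus [CompleteSpace X] {f : ℕ → C(K, ℂ)}
    (hf : Tendsto (fun n => M.m (f n) x) atTop (𝓝 z)) :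
    ∃ a : M.CyclicReal x,
      Tendsto (fun n => M.realOrbit x (modulus (f n))) atTop (𝓝 (CyclicReal.incl a)) := by
  obtain ⟨w, hw⟩ := M.exists_tendsto_apply (g := fun n => ofReal (modulus (f n))) 1
    (fun n m k => by
      rw [one_mul, ofReal_apply, ofReal_apply, ← Complex.ofReal_sub, Complex.norm_real]
      exact abs_norm_sub_norm_le (f n k) (f m k)) hf
  obtain ⟨a, rfl⟩ := CyclicReal.exists_incl_eq hw
  exact ⟨a, hw⟩

/-- Pointwise moduli of a representing sequence converge to a least upper bound, and least upper
bounds are unique. -/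
theorem isModulus_iff_tendsto [CompleteSpace X] {a : M.CyclicReal x} : M.IsModulus x z a ↔
    ∃ f : ℕ → C(K, ℂ), Tendsto (fun n => M.m (f n) x) atTop (𝓝 z) ∧
      Tendsto (fun n => M.realOrbit x (modulus (f n))) atTop (𝓝 (CyclicReal.incl a)) := by
  constructor
  · rintro ⟨u, v, rfl, hlub⟩
    obtain ⟨g, hg⟩ := u.exists_tendsto
    obtain ⟨h, hh⟩ := v.exists_tendsto
    have hf : Tendsto (fun n => M.m (ofReal (g n) + Complex.I • ofReal (h n)) x) atTop
        (𝓝 (CyclicReal.incl u + Complex.I • CyclicReal.incl v)) := by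
      simpa only [map_add, map_smul, add_apply, smul_apply, realOrbit_apply] using
        hg.add (hh.const_smul Complex.I)
    obtain ⟨a', ha'⟩ := exists_tendsto_modulus hf
    have hlub' := isLUB_of_tendsto_modulus (u := u) (v := v)
      (by simpa only [rePart_ofReal_add] using hg) (by simpa only [imPart_ofReal_add] using hh) ha'
    rw [hlub.unique hlub']
    exact ⟨_, hf, ha'⟩
  · rintro ⟨f, hf, ha⟩
    obtain ⟨u', hu⟩ := M.exists_tendsto_apply (g := fun n => ofReal (rePart (f n))) 1
      (fun n m k => by
        rw [one_mul, ofReal_apply, ofReal_apply, ← Complex.ofReal_sub, Complex.norm_real]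
        simpa [rePart] using Complex.abs_re_le_norm (f n k - f m k)) hf
    obtain ⟨v', hv⟩ := M.exists_tendsto_apply (g := fun n => ofReal (imPart (f n))) 1
      (fun n m k => by
        rw [one_mul, ofReal_apply, ofReal_apply, ← Complex.ofReal_sub, Complex.norm_real]
        simpa [imPart] using Complex.abs_im_le_norm (f n k - f m k)) hf
    obtain ⟨u, rfl⟩ := CyclicReal.exists_incl_eq hu
    obtain ⟨v, rfl⟩ := CyclicReal.exists_incl_eq hv
    refine ⟨u, v, tendsto_nhds_unique hf ?_, isLUB_of_tendsto_modulus hu hv ha⟩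
    have h := hu.add (hv.const_smul Complex.I)
    simpa only [← smul_apply, ← add_apply, ← map_smul, ← map_add, ofReal_rePart_add] using h

/-- The minimum is half of sum minus absolute difference, so its orbit converges. The limit is
positive and below both moduli, hence zero. -/
theorem CyclicDisjoint.exists_tendsto_inf [CompleteSpace X] (h : M.CyclicDisjoint x y z) :
    ∃ f g : ℕ → C(K, ℂ), Tendsto (fun n => M.m (f n) x) atTop (𝓝 y) ∧
      Tendsto (fun n => M.m (g n) x) atTop (𝓝 z) ∧
      Tendsto (fun n => M.realOrbit x (modulus (f n) ⊓ modulus (g n))) atTop (𝓝 0) := by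
  obtain ⟨a, b, ha, hb, hglb⟩ := h
  obtain ⟨f, hf, hfa⟩ := isModulus_iff_tendsto.1 ha
  obtain ⟨g, hg, hgb⟩ := isModulus_iff_tendsto.1 hb
  refine ⟨f, g, hf, hg, ?_⟩
  have hsub : Tendsto (fun n => M.realOrbit x (modulus (f n) - modulus (g n))) atTop
      (𝓝 (CyclicReal.incl a - CyclicReal.incl b)) := by
    simpa only [map_sub] using hfa.sub hgb
  obtain ⟨w, hw⟩ := exists_tendsto_realOrbit
    (s := fun n => |modulus (f n) - modulus (g n)|) (fun n m k => abs_abs_sub_abs_le _ _) hsub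
  have hinf : Tendsto (fun n => M.realOrbit x (modulus (f n) ⊓ modulus (g n))) atTop
      (𝓝 ((1 / 2 : ℝ) • (CyclicReal.incl a + CyclicReal.incl b - w))) := by
    have e : ∀ n, modulus (f n) ⊓ modulus (g n) = (1 / 2 : ℝ) •
        (modulus (f n) + modulus (g n) - |modulus (f n) - modulus (g n)|) := fun n => by
      ext k
      change min ‖f n k‖ ‖g n k‖ = (1 / 2 : ℝ) * (‖f n k‖ + ‖g n k‖ - |‖f n k‖ - ‖g n k‖|)
      rcases le_total ‖f n k‖ ‖g n k‖ with hk | hk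
      · rw [min_eq_left hk, abs_of_nonpos (by linarith)]; ring
      · rw [min_eq_right hk, abs_of_nonneg (by linarith)]; ring
    simpa only [e, map_smul, map_sub, map_add] using
      ((hfa.add hgb).sub hw).const_smul (1 / 2 : ℝ)
  obtain ⟨c, hc⟩ := CyclicReal.exists_incl_eq hinf
  rw [← hc] at hinf
  have hcone : CyclicReal.incl c ∈ M.cyclicCone x := mem_cyclicCone_iff_tendsto.2
    ⟨_, fun n k => le_min (norm_nonneg (f n k)) (norm_nonneg (g n k)), hinf⟩
  have hca : c ≤ a := CyclicReal.le_iff.2 <| mem_cyclicCone_iff_tendsto.2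
    ⟨_, fun n k => sub_nonneg.2 (min_le_left ‖f n k‖ ‖g n k‖),
      by simpa only [← map_sub] using hfa.sub hinf⟩
  have hcb : c ≤ b := CyclicReal.le_iff.2 <| mem_cyclicCone_iff_tendsto.2
    ⟨_, fun n k => sub_nonneg.2 (min_le_right ‖f n k‖ ‖g n k‖),
      by simpa only [← map_sub] using hgb.sub hinf⟩
  have hc0 : c ≤ 0 := hglb.2 (by
    rintro _ (rfl | rfl)
    · exact hca
    · exact hcb)
  rw [CyclicReal.le_iff, map_zero, zero_sub] at hc0
  rwa [M.eq_zero_of_mem_cyclicCone x hcone hc0] at hinf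

theorem CyclicDisjoint.separated [CompleteSpace X] (h : M.CyclicDisjoint x y z) :
    M.Separated y z := by
  obtain ⟨f, g, hf, hg, hinf⟩ := h.exists_tendsto_inf
  intro ε hε
  set δ : ℝ := ε / (4 * (‖x‖ + 1)) with hδ
  have hδ0 : 0 < δ := by positivity
  have hδx : δ * ‖x‖ < ε / 3 := by
    rw [hδ, div_mul_eq_mul_div, div_lt_iff₀ (by positivity)]
    nlinarith [norm_nonneg x]
  have hε3 : 0 < ε / 3 := by positivity
  obtain ⟨n, ⟨hn1, hn2⟩, hn3⟩ := (((Metric.tendsto_nhds.1 hf _ hε3).and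
    (Metric.tendsto_nhds.1 hg _ hε3)).and (Metric.tendsto_nhds.1 hinf _ hε3)).exists
  rw [dist_comm, dist_eq_norm] at hn1 hn2
  rw [dist_zero_right] at hn3
  have hpos : ∀ k, 0 < ‖f n k‖ + ‖g n k‖ + δ := fun k => by positivity
  have hconst : ‖M.realOrbit x (δ • 1)‖ = δ * ‖x‖ := by
    rw [map_smul, realOrbit_one, norm_smul, Real.norm_of_nonneg hδ0.le]
  have small : ∀ (a : C(K, ℝ)) (w : X) (q : C(K, ℂ)), (∀ k, |a k| ≤ 1) →
      (∀ k, |a k| * ‖q k‖ ≤ min ‖f n k‖ ‖g n k‖ + δ) → ‖w - M.m q x‖ < ε / 3 →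
      ‖M.realOrbit w a‖ < ε := by
    intro a w q ha hq hw
    have e : M.realOrbit w a = M.realOrbit (w - M.m q x) a + M.m (ofReal a * q) x := by
      rw [realOrbit_apply, realOrbit_apply, apply_mul, map_sub, sub_add_cancel]
    have h1 : ‖M.m (ofReal a * q) x‖ ≤ ‖M.realOrbit x (modulus (f n) ⊓ modulus (g n))‖
        + ‖M.realOrbit x (δ • 1)‖ := by
      refine M.norm_apply_le_add (fun k => ?_) x
      rw [ContinuousMap.mul_apply, norm_mul, ofReal_apply, ofReal_apply, ofReal_apply,
        Complex.norm_real, Complex.norm_real, Complex.norm_real, Real.norm_eq_abs]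
      refine (hq k).trans (add_le_add (le_abs_self _) ?_)
      simp [le_abs_self]
    calc ‖M.realOrbit w a‖ ≤ ‖M.realOrbit (w - M.m q x) a‖ + ‖M.m (ofReal a * q) x‖ := by
          rw [e]; exact norm_add_le _ _
      _ < ε := by linarith [M.norm_realOrbit_le ha (w - M.m q x)]
  -- Both `(1 - a)|f_n|` and `a |g_n|` are at most `min(|f_n|, |g_n|) + δ`.
  let a : C(K, ℝ) := ⟨fun k => ‖f n k‖ / (‖f n k‖ + ‖g n k‖ + δ),
    Continuous.div (by fun_prop) (by fun_prop) fun k => (hpos k).ne'⟩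
  have hak : ∀ k, a k = ‖f n k‖ / (‖f n k‖ + ‖g n k‖ + δ) := fun k => rfl
  have ha0 : ∀ k, 0 ≤ a k := fun k => div_nonneg (norm_nonneg _) (hpos k).le
  have ha1 : ∀ k, a k ≤ 1 := fun k =>
    (div_le_one (hpos k)).2 (by linarith [norm_nonneg (g n k)])
  have ha1' : ∀ k, 0 ≤ (1 - a) k := fun k => sub_nonneg.2 (ha1 k)
  have hae : ∀ k, (1 - a) k = (‖g n k‖ + δ) / (‖f n k‖ + ‖g n k‖ + δ) := fun k => by
    rw [ContinuousMap.sub_apply, ContinuousMap.one_apply, hak, one_sub_div (hpos k).ne']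
    ring
  refine ⟨a, ha0, ha1, small _ _ (f n) (fun k => ?_) (fun k => ?_) hn1,
    small _ _ (g n) (fun k => ?_) (fun k => ?_) hn2⟩
  · rw [abs_of_nonneg (ha1' k), ContinuousMap.sub_apply, ContinuousMap.one_apply]
    linarith [ha0 k]
  · rw [abs_of_nonneg (ha1' k), hae, ← min_add_add_right, div_mul_eq_mul_div,
      div_le_iff₀ (hpos k)]
    have hf0 := norm_nonneg (f n k)
    have hg0 := norm_nonneg (g n k)
    rcases min_choice (‖f n k‖ + δ) (‖g n k‖ + δ) with e | e <;> rw [e] <;>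
      nlinarith [mul_nonneg hf0 hg0]
  · rw [abs_of_nonneg (ha0 k)]
    exact ha1 k
  · rw [abs_of_nonneg (ha0 k), hak, ← min_add_add_right, div_mul_eq_mul_div,
      div_le_iff₀ (hpos k)]
    have hf0 := norm_nonneg (f n k)
    have hg0 := norm_nonneg (g n k)
    rcases min_choice (‖f n k‖ + δ) (‖g n k‖ + δ) with e | e <;> rw [e] <;>
      nlinarith [mul_nonneg hf0 hg0]

/-- Pointwise `min(|f|, |g|) ≤ (1 - a)|f| + a|g|`. Two errors of `ε / 4` come from separation and
two from approximating `y` and `z`. -/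
theorem Separated.tendsto_realOrbit_inf {f g : ℕ → C(K, ℂ)} (h : M.Separated y z)
    (hf : Tendsto (fun n => M.m (f n) x) atTop (𝓝 y))
    (hg : Tendsto (fun n => M.m (g n) x) atTop (𝓝 z)) :
    Tendsto (fun n => M.realOrbit x (modulus (f n) ⊓ modulus (g n))) atTop (𝓝 0) := by
  rw [Metric.tendsto_nhds]
  intro ε hε
  have hε4 : 0 < ε / 4 := by positivity
  obtain ⟨a, ha0, ha1, hy, hz⟩ := h (ε / 4) hε4
  filter_upwards [Metric.tendsto_nhds.1 hf _ hε4, Metric.tendsto_nhds.1 hg _ hε4] with n hn1 hn2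
  rw [dist_eq_norm] at hn1 hn2
  rw [dist_zero_right]
  have ha1' : ∀ k, 0 ≤ (1 - a) k := fun k => sub_nonneg.2 (ha1 k)
  have near : ∀ (b : C(K, ℝ)) (w : X) (q : C(K, ℂ)), (∀ k, |b k| ≤ 1) →
      ‖M.m (ofReal b * q) x‖ ≤ ‖M.realOrbit w b‖ + ‖M.m q x - w‖ := by
    intro b w q hb
    have e : M.m (ofReal b * q) x = M.realOrbit w b + M.realOrbit (M.m q x - w) b := by
      rw [realOrbit_apply, realOrbit_apply, apply_mul, map_sub, add_sub_cancel]
    rw [e]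
    exact (norm_add_le _ _).trans (by gcongr; exact M.norm_realOrbit_le hb _)
  have h1 := near (1 - a) y (f n) fun k => by
    rw [abs_of_nonneg (ha1' k), ContinuousMap.sub_apply, ContinuousMap.one_apply]
    linarith [ha0 k]
  have h2 := near a z (g n) fun k => by
    rw [abs_of_nonneg (ha0 k)]; exact ha1 k
  have h3 : ‖M.realOrbit x (modulus (f n) ⊓ modulus (g n))‖
      ≤ ‖M.m (ofReal (1 - a) * f n) x‖ + ‖M.m (ofReal a * g n) x‖ := by
    refine M.norm_apply_le_add (fun k => ?_) x
    have hmin0 : 0 ≤ min ‖f n k‖ ‖g n k‖ := le_min (norm_nonneg _) (norm_nonneg _)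
    rw [ContinuousMap.mul_apply, ContinuousMap.mul_apply, norm_mul, norm_mul, ofReal_apply,
      ofReal_apply, ofReal_apply, Complex.norm_real, Complex.norm_real, Complex.norm_real,
      Real.norm_of_nonneg (ha0 k), Real.norm_of_nonneg (ha1' k)]
    change ‖min ‖f n k‖ ‖g n k‖‖ ≤ _
    rw [Real.norm_of_nonneg hmin0]
    have e1 := mul_le_mul_of_nonneg_left (min_le_left ‖f n k‖ ‖g n k‖) (ha1' k)
    have e2 := mul_le_mul_of_nonneg_left (min_le_right ‖f n k‖ ‖g n k‖) (ha0 k)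
    rw [ContinuousMap.sub_apply, ContinuousMap.one_apply] at e1 ⊢
    linarith
  linarith

theorem Separated.cyclicDisjoint [CompleteSpace X] (h : M.Separated y z)
    (hy : y ∈ M.cyclicSubspace x) (hz : z ∈ M.cyclicSubspace x) : M.CyclicDisjoint x y z := by
  obtain ⟨f, hf⟩ := M.mem_cyclicSubspace_iff_tendsto.1 hy
  obtain ⟨g, hg⟩ := M.mem_cyclicSubspace_iff_tendsto.1 hz
  obtain ⟨a, ha⟩ := exists_tendsto_modulus hf
  obtain ⟨b, hb⟩ := exists_tendsto_modulus hg
  have hinf := h.tendsto_realOrbit_inf hf hg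
  refine ⟨a, b, isModulus_iff_tendsto.2 ⟨f, hf, ha⟩, isModulus_iff_tendsto.2 ⟨g, hg, hb⟩, ?_, ?_⟩
  · rintro _ (rfl | rfl) <;> rw [CyclicReal.le_iff, map_zero, sub_zero]
    · exact mem_cyclicCone_iff_tendsto.2 ⟨_, fun n k => norm_nonneg (f n k), ha⟩
    · exact mem_cyclicCone_iff_tendsto.2 ⟨_, fun n k => norm_nonneg (g n k), hb⟩
  · intro c hc
    have hca := CyclicReal.le_iff.1 (hc (Set.mem_insert a {b}))
    have hcb := CyclicReal.le_iff.1 (hc (Set.mem_insert_of_mem a rfl))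
    obtain ⟨r, hr⟩ := c.exists_tendsto
    have h1 := tendsto_realOrbit_negPart (r := fun n => modulus (f n) - r n)
      (by simpa only [map_sub] using ha.sub hr) hca
    have h2 := tendsto_realOrbit_negPart (r := fun n => modulus (g n) - r n)
      (by simpa only [map_sub] using hb.sub hr) hcb
    rw [CyclicReal.le_iff, map_zero, zero_sub]
    refine mem_cyclicCone_of_tendsto_negPart (r := fun n => -r n)
      (by simpa only [map_neg] using hr.neg) ?_
    -- For a lower bound represented by `r_n`, `r_n⁺ ≤ min(|f_n|, |g_n|) + (r_n - |f_n|)⁺ + (r_n -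
    -- |g_n|)⁺`.
    have hsum : Tendsto (fun n => ‖M.realOrbit x (modulus (f n) ⊓ modulus (g n)
        + ((-(modulus (f n) - r n) ⊔ 0) + (-(modulus (g n) - r n) ⊔ 0)))‖) atTop (𝓝 0) := by
      simpa only [map_add, add_zero, norm_zero] using (hinf.add (h1.add h2)).norm
    refine squeeze_zero_norm (fun n => M.norm_realOrbit_mono (fun k => ?_) x) hsum
    refine le_trans ?_ (le_abs_self _)
    change |max (- -r n k) 0| ≤ min ‖f n k‖ ‖g n k‖
      + (max (-(‖f n k‖ - r n k)) 0 + max (-(‖g n k‖ - r n k)) 0)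
    have p1 := le_max_left (-(‖f n k‖ - r n k)) 0
    have p2 := le_max_left (-(‖g n k‖ - r n k)) 0
    have p3 := le_max_right (-(‖f n k‖ - r n k)) 0
    have p4 := le_max_right (-(‖g n k‖ - r n k)) 0
    have hf0 := norm_nonneg (f n k)
    have hg0 := norm_nonneg (g n k)
    rw [abs_of_nonneg (le_max_right _ _)]
    rcases min_choice ‖f n k‖ ‖g n k‖ with e | e <;> rw [e] <;> refine max_le ?_ ?_ <;> linarith

end CyclicLattice

end BanachCKModule

/-! ### The equivalence. -/

theorem mainTheorem12 {K L X Y : Type*}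
    [TopologicalSpace K] [CompactSpace K] [T2Space K]
    [TopologicalSpace L] [CompactSpace L] [T2Space L]
    [NormedAddCommGroup X] [NormedSpace ℂ X] [CompleteSpace X]
    [NormedAddCommGroup Y] [NormedSpace ℂ Y] [CompleteSpace Y]
    (M : BanachCKModule K X) (N : BanachCKModule L Y) (T : X →L[ℂ] Y) :
    (∀ x y : X, M.DDisjoint x y → N.DDisjoint (T x) (T y)) ↔
      (∀ x : X,
        (∀ z ∈ M.cyclicSubspace x, T z ∈ N.cyclicSubspace (T x)) ∧
        (∀ y ∈ M.cyclicSubspace x, ∀ z ∈ M.cyclicSubspace x,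
          M.CyclicDisjoint x y z → N.CyclicDisjoint (T x) (T y) (T z))) := by
  simp only [BanachCKModule.dDisjoint_iff_separated]
  constructor
  · intro h x
    have hmem := fun z (hz : z ∈ M.cyclicSubspace x) => M.map_mem_cyclicSubspace N T h hz
    exact ⟨hmem, fun y hy z hz hyz => (h y z hyz.separated).cyclicDisjoint (hmem y hy) (hmem z hz)⟩
  · intro h x y hxy
    -- Separated vectors share the cyclic subspace of their sum, so the second condition is applied
    -- at `x + y`.
    have hx : x ∈ M.cyclicSubspace (x + y) := M.Delta_subset_cyclicSubspace <| by
      simpa using hxy.add_mem_Delta (M.self_mem_Delta x) (M.zero_mem_Delta y)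
    have hy : y ∈ M.cyclicSubspace (x + y) := M.Delta_subset_cyclicSubspace <| by
      simpa using hxy.add_mem_Delta (M.zero_mem_Delta x) (M.self_mem_Delta y)
    exact ((h (x + y)).2 x hx y hy (hxy.cyclicDisjoint hx hy)).separated
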